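/- Let $f$ be a meromorphic function on $\mathbb{C}$. For $\eta\in\mathbb{C}\setminus\{0\}$ write $\Delta_\eta g(z)=g(z+\eta)-g(z)$. For $a\in\mathbb{C}$ let $n_{\Delta_\eta}\big(t,\tfrac1{f-a}\big)$ be the number of common zeros of $f-a$ and $\Delta_\eta f$ in $\{|z|\le t\}$, each counted with the minimum of its two multiplicities; for $a=\infty$ replace $f-a$ and $\Delta_\eta f$ by $1/f$ and $\Delta_\eta(1/f)$ (and write $n_{\Delta_\eta}(t,f)$). Put $$N_{\Delta_\eta}\Big(r,\frac1{f-a}\Big)=\int_0^r\frac{n_{\Delta_\eta}\big(t,\frac1{f-a}\big)-n_{\Delta_\eta}\big(0,\frac1{f-a}\big)}{t}\,dt+n_{\Delta_\eta}\Big(0,\frac1{f-a}\Big)\log r,$$ and $\widetilde N_{\Delta_\eta}\big(r,\tfrac1{f-a}\big)=N\big(r,\tfrac1{f-a}\big)-N_{\Delta_\eta}\big(r,\tfrac1{f-a}\big)$, where $N$ is the Nevanlinna integrated counting function of the $a$-points of $f$ with multiplicity (of the poles of $f$ if $a=\infty$). Call $a\in\widehat{\mathbb{C}}=\mathbb{C}\cup\{\infty\}$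 a Picard exceptional value of $f$ for the varying-steps difference operator with vanishing period if there is a sequence of nonzero complex numbers $\eta_n\to0$ such that, for every $n$, $\widetilde N_{\Delta_{\eta_n}}\big(r,\tfrac1{f-a}\big)=O(1)$ as $r\to\infty$. Theorem. If $f$ has three distinct Picard exceptional values for the varying-steps difference operator with vanishing period, then $f$ is constant. Moreover, every value of $\widehat{\mathbb{C}}$ that $f$ omits is a Picard exceptional value in this sense; consequently a meromorphic function on $\mathbb{C}$ that omits three distinct values of $\widehat{\mathbb{C}}$ is constant. No growth restriction is imposed on $f$. -/

import Mathlib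

open Filter Topology Metric

noncomputable section

/-- The multiplicity of `z` as a common zero of the meromorphic functions `g` and `h`: the minimum
of the multiplicities of `z` as a zero of `g` and as a zero of `h`, which is `0` if `z` is not a
zero of both. The zero function has a zero of multiplicity `⊤` at every point, so if only `h`
vanishes identically, the value is the multiplicity of the zero of `g`. -/
def commonZeroMult (g h : ℂ → ℂ) (z : ℂ) : ℤ :=
  (max 0 (min (meromorphicOrderAt g z) (meromorphicOrderAt h z))).untop₀

/-- The number of common zeros of `g` and `h` in the closed disc of radius `t` around `0`,
counted with multiplicity. -/
def commonZeroCount (g h : ℂ → ℂ) (t : ℝ) : ℝ :=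
  ∑ᶠ z ∈ closedBall (0 : ℂ) t, (commonZeroMult g h z : ℝ)

/-- The difference counting function of `f` with step `η` at a value `a` of the Riemann sphere:
for `a ≠ ∞` it counts the common zeros of `f - a` and `Δ_η f`,
for `a = ∞` the common zeros of `1 / f` and `Δ_η (1 / f)`, where `Δ_η g (z) = g (z + η) - g z`.
As in Mathlib's value distribution theory, the sphere is `WithTop ℂ`, with `⊤` for `∞`. -/
def diffCounting (η : ℂ) (f : ℂ → ℂ) (a : WithTop ℂ) (t : ℝ) : ℝ :=
  WithTop.recTopCoe (C := fun _ => ℝ)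
    (commonZeroCount (fun z => (f z)⁻¹) (fwdDiff η (fun z => (f z)⁻¹)) t)
    (fun a₀ : ℂ => commonZeroCount (fun z => f z - a₀) (fwdDiff η f) t) a

/-- The integrated difference counting function `N_{Δ_η}(r, 1/(f-a))`
(which is `N_{Δ_η}(r, f)` for `a = ∞`). -/
def diffLogCounting (η : ℂ) (f : ℂ → ℂ) (a : WithTop ℂ) (r : ℝ) : ℝ :=
  (∫ t in (0 : ℝ)..r, (diffCounting η f a t - diffCounting η f a 0) / t)
    + diffCounting η f a 0 * Real.log r

/-- The reduced difference counting function
`Ñ_{Δ_η}(r, 1/(f-a)) = N(r, 1/(f-a)) - N_{Δ_η}(r, 1/(f-a))`. -/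
def reducedDiffLogCounting (η : ℂ) (f : ℂ → ℂ) (a : WithTop ℂ) (r : ℝ) : ℝ :=
  ValueDistribution.logCounting f a r - diffLogCounting η f a r

/-- `a` is a Picard exceptional value of `f` for the varying-steps difference operator with
vanishing period: for some sequence of nonzero steps `η n → 0`, each of the functions
`r ↦ Ñ_{Δ_{η n}}(r, 1/(f-a))` is `O(1)` as `r → ∞`. -/
def IsVanishingPicardExceptional (f : ℂ → ℂ) (a : WithTop ℂ) : Prop :=
  ∃ η : ℕ → ℂ, (∀ n, η n ≠ 0) ∧ Tendsto η atTop (𝓝 0) ∧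
    ∀ n, (fun r : ℝ => reducedDiffLogCounting (η n) f a r) =O[atTop] (fun _ : ℝ => (1 : ℝ))

/-- The meromorphic function `f` omits the value `a` of the Riemann sphere:
`f - a` has no zeros if `a ≠ ∞`, and `f` has no poles if `a = ∞`. -/
def OmitsValue (f : ℂ → ℂ) (a : WithTop ℂ) : Prop :=
  WithTop.recTopCoe (C := fun _ => Prop)
    (∀ z, 0 ≤ meromorphicOrderAt f z)
    (fun a₀ : ℂ => ∀ z, meromorphicOrderAt (fun w => f w - a₀) z ≤ 0) a

/-- `f` is constant as a meromorphic function. Two functions `ℂ → ℂ` that are meromorphic in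
Mathlib's sense represent the same meromorphic function if they agree outside a closed discrete
set. -/
def IsConstMeromorphic (f : ℂ → ℂ) : Prop :=
  ∃ c : ℂ, f =ᶠ[codiscrete ℂ] fun _ => c

end

/-! Exceptional values of a nonconstant `f` turn out to be omitted, so everything reduces to the
little Picard theorem, which is proved independently. Let `g` be `f - a`, or `1 / f` for `a = ∞`.
The reduced counting function belongs to the effective divisor "zeros of `g` minus common zeros of
`g` and `Δ_η g`". An effective divisor with bounded logarithmic counting function is zero, so `Δ_η
g` vanishes wherever `g` does (`meromorphicOrderAt_pos_of_isBigO`). A zero `z` of `g` then forces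
zeros at all `z + η n`, which accumulate at `z`; this is impossible unless `g` vanishes identically
(`meromorphicOrderAt_nonpos_of_isBigO_fwdDiff`). Growth of `f` plays no role. Conversely, for an
omitted value both counting functions vanish for every step. Little Picard follows Landau and König:
two nested cosines turn an entire function omitting two values into one whose range contains no disc
of radius 2, and Bloch's theorem makes that function constant. -/

/-! ### Bloch's theorem for entire functions -/

/-- A Bloch-type covering lemma: if `‖f'‖` is at most twice its value at the centre of a disc of
radius `r`, then the image contains a disc of radius `r * ‖f' a‖ / 24`. -/
theorem ball_subset_range_of_norm_deriv_le {f : ℂ → ℂ} (hf : Differentiable ℂ f) {a : ℂ} {r : ℝ}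
    (hr : 0 < r) (ha : deriv f a ≠ 0)
    (hbd : ∀ z ∈ ball a r, ‖deriv f z‖ ≤ 2 * ‖deriv f a‖) :
    ball (f a) (r * ‖deriv f a‖ / 24) ⊆ Set.range f := by
  set m := ‖deriv f a‖ with hm
  have hm0 : 0 < m := norm_pos_iff.2 ha
  have hd : Differentiable ℂ (deriv f) := hf.deriv
  have hschw : ∀ z ∈ ball a r, ‖deriv f z - deriv f a‖ ≤ 3 * m / r * ‖z - a‖ := by
    intro z hz
    have := Complex.dist_le_div_mul_dist_of_mapsTo_ball (R₂ := 3 * m) hd.differentiableOn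
      (fun w hw => by
        rw [mem_closedBall, dist_eq_norm]
        linarith [norm_sub_le (deriv f w) (deriv f a), hbd w hw]) hz
    simpa [dist_eq_norm] using this
  -- The radius `r / 6` makes the Schwarz bound `3 * m / r * ‖z - a‖` at most `m / 2`, so the linear
  -- part of `f` dominates. The quantitative open mapping theorem then halves the bound `r * m / 12`
  -- on the sphere.
  have hlin : ∀ z ∈ closedBall a (r / 6), ‖f z - f a - deriv f a * (z - a)‖ ≤ m / 2 * ‖z - a‖ := by
    intro z hz
    have := (convex_closedBall a (r / 6)).norm_image_sub_le_of_norm_hasDerivWithin_le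
      (f := fun w => f w - deriv f a * (w - a)) (f' := fun w => deriv f w - deriv f a) (C := m / 2)
      (x := a) (y := z) (fun w _ => by
        have h := ((hf w).hasDerivAt.sub (((hasDerivAt_id w).sub_const a).const_mul (deriv f a)))
        rw [mul_one] at h
        exact h.hasDerivWithinAt)
      (fun w hw => by
        rw [mem_closedBall, dist_eq_norm] at hw
        have hw' : w ∈ ball a r := by rw [mem_ball, dist_eq_norm]; linarith
        refine (hschw w hw').trans ?_
        calc 3 * m / r * ‖w - a‖ ≤ 3 * m / r * (r / 6) := by gcongr
          _ = m / 2 := by field_simp; norm_num)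
      (mem_closedBall_self (by positivity)) hz
    simpa [sub_right_comm] using this
  have hsphere : ∀ z ∈ sphere a (r / 6), r * m / 12 ≤ ‖f z - f a‖ := by
    intro z hz
    have h1 := hlin z (sphere_subset_closedBall hz)
    rw [mem_sphere, dist_eq_norm] at hz
    have h2 := norm_sub_norm_le (deriv f a * (z - a)) (deriv f a * (z - a) - (f z - f a))
    rw [sub_sub_cancel, norm_sub_rev, norm_mul, hz] at h2
    rw [hz] at h1
    linarith
  have hfreq : ∃ᶠ z in 𝓝 a, f z ≠ f a := by
    intro h
    apply ha
    have : f =ᶠ[𝓝 a] fun _ => f a := h.mono fun z hz => not_not.1 hz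
    rw [this.deriv_eq, deriv_const]
  have := hf.diffContOnCl.ball_subset_image_closedBall (by positivity : 0 < r / 6) hsphere hfreq
  rw [show r * m / 24 = r * m / 12 / 2 by ring]
  exact this.trans (Set.image_subset_range _ _)

/-- **Bloch's theorem** for entire functions: the range of a nonconstant entire function contains
discs of arbitrarily large radius. -/
theorem exists_ball_subset_range {f : ℂ → ℂ} (hf : Differentiable ℂ f) {z₀ : ℂ}
    (h₀ : deriv f z₀ ≠ 0) (R : ℝ) : ∃ c, ball c R ⊆ Set.range f := by
  set m := ‖deriv f z₀‖ with hm
  have hm0 : 0 < m := norm_pos_iff.2 h₀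
  obtain ⟨ρ, hρ0, hρ⟩ : ∃ ρ : ℝ, 0 < ρ ∧ R ≤ ρ * m / 48 := by
    refine ⟨(|R| + 1) * 48 / m, by positivity, ?_⟩
    rw [div_mul_cancel₀ _ hm0.ne', mul_div_cancel_right₀ _ (by norm_num)]
    linarith [le_abs_self R]
  -- Landau's trick: at a maximum `a` of this weighted derivative, `‖f'‖` can at most double on the
  -- disc of radius `(ρ - ‖a - z₀‖) / 2`, because the weight at most halves there.
  have hcont : ContinuousOn (fun z => (ρ - ‖z - z₀‖) * ‖deriv f z‖) (closedBall z₀ ρ) := by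
    have := hf.deriv.continuous
    fun_prop
  obtain ⟨a, ha, hmax⟩ := (isCompact_closedBall z₀ ρ).exists_isMaxOn
    ⟨z₀, mem_closedBall_self hρ0.le⟩ hcont
  have hM : ρ * m ≤ (ρ - ‖a - z₀‖) * ‖deriv f a‖ := by
    simpa using hmax (mem_closedBall_self hρ0.le)
  have hMpos : 0 < (ρ - ‖a - z₀‖) * ‖deriv f a‖ := (by positivity : 0 < ρ * m).trans_le hM
  have hda : 0 < ‖deriv f a‖ := pos_of_mul_pos_right hMpos
    (by rw [mem_closedBall, dist_eq_norm] at ha; linarith)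
  have hr : 0 < ρ - ‖a - z₀‖ := pos_of_mul_pos_left hMpos hda.le
  refine ⟨f a, (ball_subset_ball ?_).trans (ball_subset_range_of_norm_deriv_le hf (half_pos hr)
    (norm_pos_iff.1 hda) fun z hz => ?_)⟩
  · linarith
  · rw [mem_ball, dist_eq_norm] at hz
    have hz' : ‖z - z₀‖ ≤ ‖z - a‖ + ‖a - z₀‖ := by
      simpa using norm_add_le (z - a) (a - z₀)
    have h1 : (ρ - ‖z - z₀‖) * ‖deriv f z‖ ≤ (ρ - ‖a - z₀‖) * ‖deriv f a‖ :=
      hmax (show z ∈ closedBall z₀ ρ by rw [mem_closedBall, dist_eq_norm]; linarith)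
    have h2 : (ρ - ‖a - z₀‖) / 2 * ‖deriv f z‖ ≤ (ρ - ‖z - z₀‖) * ‖deriv f z‖ := by
      gcongr; linarith
    refine le_of_mul_le_mul_left ?_ (half_pos hr)
    linarith

/-! ### Entire functions omitting two values -/

/-- A zero-free entire function has an entire logarithm. -/
theorem exists_exp_eq_of_differentiable {f : ℂ → ℂ} (hf : Differentiable ℂ f) (h0 : ∀ z, f z ≠ 0) :
    ∃ g : ℂ → ℂ, Differentiable ℂ g ∧ ∀ z, Complex.exp (g z) = f z := by
  obtain ⟨g, hg0, hg⟩ := (hf.deriv.div hf h0).isExactOn_univ.with_val_at 0 (Complex.log (f 0))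
  replace hg z : HasDerivAt g (deriv f z / f z) z := hg z trivial
  refine ⟨g, fun z => (hg z).differentiableAt, fun z => ?_⟩
  have hder w : HasDerivAt (fun w => Complex.exp (-g w) * f w) 0 w := by
    refine ((hg w).neg.cexp.mul (hf w).hasDerivAt).congr_deriv ?_
    field_simp [h0 w]
    ring
  have hconst := is_const_of_deriv_eq_zero (fun w => (hder w).differentiableAt)
    (fun w => (hder w).deriv) z 0
  simp only [hg0, Complex.exp_neg, Complex.exp_log (h0 0), inv_mul_cancel₀ (h0 0)] at hconst
  exact ((inv_mul_eq_one₀ (Complex.exp_ne_zero _)).1 hconst)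

/-- An entire function omitting `1` and `-1` is the cosine of an entire function. -/
theorem exists_cos_pi_mul_eq_of_differentiable {f : ℂ → ℂ} (hf : Differentiable ℂ f)
    (h1 : ∀ z, f z ≠ 1) (h2 : ∀ z, f z ≠ -1) :
    ∃ g : ℂ → ℂ, Differentiable ℂ g ∧ ∀ z, f z = Complex.cos (Real.pi * g z) := by
  obtain ⟨u, hu, hu'⟩ := exists_exp_eq_of_differentiable (f := fun z => (f z - 1) * (f z + 1))
    (by fun_prop) fun z => mul_ne_zero (sub_ne_zero.2 (h1 z)) (by
      simpa [← eq_neg_iff_add_eq_zero] using h2 z)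
  -- `s` is an entire square root of `f ^ 2 - 1`, so `f + s` and `f - s` are mutually inverse; with
  -- `f + s = exp v`, `f` is the mean of `exp v` and `exp (-v)`.
  set s : ℂ → ℂ := fun z => Complex.exp (u z / 2) with hs
  have hsq z : s z * s z = (f z - 1) * (f z + 1) := by
    rw [← hu', hs, ← Complex.exp_add, add_halves]
  have hmul z : (f z + s z) * (f z - s z) = 1 := by linear_combination -hsq z
  have hne z : f z + s z ≠ 0 := left_ne_zero_of_mul_eq_one (hmul z)
  obtain ⟨v, hv, hv'⟩ := exists_exp_eq_of_differentiable (f := fun z => f z + s z) (by fun_prop) hne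
  have hpi : (Real.pi : ℂ) ≠ 0 := by exact_mod_cast Real.pi_ne_zero
  refine ⟨fun z => v z / (Real.pi * Complex.I), by fun_prop, fun z => ?_⟩
  have harg : (Real.pi : ℂ) * (v z / (Real.pi * Complex.I)) * Complex.I = v z := by
    field_simp
  rw [Complex.cos, neg_mul, harg, Complex.exp_neg, hv', inv_eq_of_mul_eq_one_right (hmul z)]
  ring

theorem cos_pi_mul_intCast_eq_or (n : ℤ) :
    Complex.cos (Real.pi * n) = 1 ∨ Complex.cos (Real.pi * n) = -1 := by
  have h : Complex.cos (Real.pi * n) = ((-1 : ℝ) ^ n : ℝ) := by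
    rw [← Real.cos_int_mul_pi, mul_comm]
    push_cast
    rfl
  rcases Int.even_or_odd n with hn | hn
  · left; rw [h, hn.neg_one_zpow, Complex.ofReal_one]
  · right; rw [h, hn.neg_one_zpow, Complex.ofReal_neg, Complex.ofReal_one]

/-- The points where `cos (π w)` is an integer meet every disc of radius `2`. -/
theorem exists_mem_ball_cos_pi_mul_eq_intCast (c : ℂ) :
    ∃ w ∈ ball c 2, ∃ n : ℤ, Complex.cos (Real.pi * w) = n := by
  have hcosh : (2 : ℝ) ≤ Real.cosh Real.pi := by
    rw [Real.cosh_eq]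
    have := Real.add_one_le_exp Real.pi
    have := Real.exp_pos (-Real.pi)
    linarith [Real.pi_gt_three]
  -- On a vertical line with integer real part `cos (π w)` is `± cosh (π Im w)`. Raising the height
  -- by 1 at least doubles this `cosh`, which is at least 1, so an integer is crossed.
  obtain ⟨t, ht, hN⟩ : ∃ t ∈ Set.Icc |c.im| (|c.im| + 1),
      Real.cosh (Real.pi * t) = ⌈Real.cosh (Real.pi * |c.im|)⌉ := by
    refine intermediate_value_Icc (by linarith) (by fun_prop) ⟨Int.le_ceil _, ?_⟩
    refine (Int.ceil_lt_add_one _).le.trans ?_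
    rw [mul_add, mul_one, Real.cosh_add]
    have h1 := Real.one_le_cosh (Real.pi * |c.im|)
    have h2 : 0 ≤ Real.sinh (Real.pi * |c.im|) * Real.sinh Real.pi :=
      mul_nonneg (Real.sinh_nonneg_iff.2 (by positivity)) (Real.sinh_nonneg_iff.2 Real.pi_pos.le)
    nlinarith
  obtain ⟨s, hs, hsN⟩ : ∃ s : ℝ, |s - c.im| ≤ 1 ∧
      Real.cosh (Real.pi * s) = ⌈Real.cosh (Real.pi * |c.im|)⌉ := by
    rcases abs_cases c.im with ⟨h, _⟩ | ⟨h, _⟩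
    · exact ⟨t, by rw [abs_le]; constructor <;> linarith [ht.1, ht.2], hN⟩
    · exact ⟨-t, by rw [abs_le]; constructor <;> linarith [ht.1, ht.2],
        by rw [mul_neg, Real.cosh_neg, hN]⟩
  set m := round c.re
  have hm : |(m : ℝ) - c.re| ≤ 1 / 2 := by
    rw [abs_sub_comm]; exact abs_sub_round c.re
  obtain ⟨e, he⟩ : ∃ e : ℤ, Complex.cos (Real.pi * m) = e := by
    rcases cos_pi_mul_intCast_eq_or m with h | h
    · exact ⟨1, by rw [h, Int.cast_one]⟩
    · exact ⟨-1, by rw [h, Int.cast_neg, Int.cast_one]⟩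
  refine ⟨m + s * Complex.I, ?_, e * ⌈Real.cosh (Real.pi * |c.im|)⌉, ?_⟩
  · rw [mem_ball, dist_eq_norm]
    refine (Complex.norm_le_abs_re_add_abs_im _).trans_lt ?_
    simp
    linarith
  · have h1 : (Real.pi : ℂ) * (m + s * Complex.I) =
        Real.pi * m + (Real.pi * s : ℝ) * Complex.I := by
      push_cast; ring
    have h2 : Complex.sin (Real.pi * m) = 0 := by
      rw [mul_comm]; exact Complex.sin_int_mul_pi m
    rw [h1, Complex.cos_add, h2, Complex.cos_mul_I, he, ← Complex.ofReal_cosh, hsN]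
    push_cast
    ring

/-- **Little Picard theorem** for entire functions. -/
theorem exists_eq_const_of_differentiable_of_ne {f : ℂ → ℂ} (hf : Differentiable ℂ f) {a b : ℂ}
    (hab : a ≠ b) (ha : ∀ z, f z ≠ a) (hb : ∀ z, f z ≠ b) : ∃ c, ∀ z, f z = c := by
  have hba : b - a ≠ 0 := sub_ne_zero.2 hab.symm
  -- The affine normalisation sends `a` and `b` to `-1` and `1`. These are the values of `cos (π
  -- n)`, so `F` omits every integer.
  obtain ⟨F, hF, hfF⟩ := exists_cos_pi_mul_eq_of_differentiable
    (f := fun z => 2 * ((f z - a) / (b - a)) - 1) (by fun_prop)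
    (fun z h => hb z (by field_simp at h; linear_combination h / 2))
    (fun z h => ha z (by field_simp at h; linear_combination h / 2))
  have hint z (n : ℤ) : F z ≠ n := by
    intro h
    have h1 := hfF z
    rw [h] at h1
    rcases cos_pi_mul_intCast_eq_or n with hn | hn <;> rw [hn] at h1
    · exact hb z (by field_simp at h1; linear_combination h1 / 2)
    · exact ha z (by field_simp at h1; linear_combination h1 / 2)
  obtain ⟨G, hG, hFG⟩ := exists_cos_pi_mul_eq_of_differentiable hF (fun z => by exact_mod_cast hint z 1)
    (fun z => by exact_mod_cast hint z (-1))
  have hderiv z : deriv G z = 0 := by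
    by_contra h
    obtain ⟨c, hc⟩ := exists_ball_subset_range hG h 2
    obtain ⟨w, hw, n, hn⟩ := exists_mem_ball_cos_pi_mul_eq_intCast c
    obtain ⟨z, rfl⟩ := hc hw
    exact hint z n ((hFG z).trans hn)
  refine ⟨f 0, fun z => ?_⟩
  have h1 := hfF z
  rw [hFG z, is_const_of_deriv_eq_zero hG hderiv z 0, ← hFG 0, ← hfF 0] at h1
  field_simp at h1
  linear_combination h1 / 2

/-! ### Little Picard for meromorphic functions -/

theorem Meromorphic.meromorphicOrderAt_eq_top {g : ℂ → ℂ} (hg : Meromorphic g) {z₀ : ℂ}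
    (h : meromorphicOrderAt g z₀ = ⊤) (z : ℂ) : meromorphicOrderAt g z = ⊤ := by
  by_contra hz
  exact (meromorphicOn_univ.2 hg).meromorphicOrderAt_ne_top_of_isPreconnected isPreconnected_univ
    trivial trivial hz h

theorem isConstMeromorphic_of_eventuallyEq {f : ℂ → ℂ} {c : ℂ}
    (h : ∀ z, f =ᶠ[𝓝[≠] z] fun _ => c) : IsConstMeromorphic f := by
  refine ⟨c, ?_⟩
  rw [EventuallyEq, Filter.Eventually, mem_codiscrete]
  intro z
  rw [disjoint_principal_right, compl_compl]
  exact h z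

theorem isConstMeromorphic_of_meromorphicOrderAt_sub_eq_top {f : ℂ → ℂ} (hf : Meromorphic f)
    {c z₀ : ℂ} (h : meromorphicOrderAt (fun z => f z - c) z₀ = ⊤) : IsConstMeromorphic f := by
  have hg : Meromorphic fun z => f z - c := fun z => (hf z).sub (MeromorphicAt.const c z)
  refine isConstMeromorphic_of_eventuallyEq (c := c) fun z => ?_
  filter_upwards [meromorphicOrderAt_eq_top_iff.1 (hg.meromorphicOrderAt_eq_top h z)] with w hw
  exact sub_eq_zero.1 hw

/-- A meromorphic function without poles agrees with an entire function near every point, except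
possibly at the point itself. -/
theorem Meromorphic.exists_differentiable_eventuallyEq {f : ℂ → ℂ} (hf : Meromorphic f)
    (h : ∀ z, 0 ≤ meromorphicOrderAt f z) :
    ∃ F : ℂ → ℂ, Differentiable ℂ F ∧ ∀ z, F =ᶠ[𝓝[≠] z] f := by
  have hf' := meromorphicOn_univ.2 hf
  have hF z := hf'.toMeromorphicNFOn_eq_self_on_nhdsNE (Set.mem_univ z)
  refine ⟨toMeromorphicNFOn f Set.univ, fun z => ?_, hF⟩
  have hNF := meromorphicNFOn_toMeromorphicNFOn f Set.univ (Set.mem_univ z)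
  refine (hNF.meromorphicOrderAt_nonneg_iff_analyticAt.1 ?_).differentiableAt
  rw [meromorphicOrderAt_congr (hF z)]
  exact h z

theorem ne_of_meromorphicOrderAt_sub_nonpos {f F : ℂ → ℂ} {z a : ℂ} (hf : MeromorphicAt f z)
    (hF : ContinuousAt F z) (hFf : F =ᶠ[𝓝[≠] z] f)
    (h : meromorphicOrderAt (fun w => f w - a) z ≤ 0) : F z ≠ a := by
  rintro rfl
  refine h.not_gt ((tendsto_zero_iff_meromorphicOrderAt_pos
    (hf.sub (MeromorphicAt.const _ z))).1 ?_)
  have h1 : Tendsto f (𝓝[≠] z) (𝓝 (F z)) := (hF.tendsto.mono_left nhdsWithin_le_nhds).congr' hFf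
  have h2 := h1.sub_const (F z)
  rw [sub_self] at h2
  exact h2

theorem isConstMeromorphic_of_omits_top {f : ℂ → ℂ} (hf : Meromorphic f) {a b : ℂ} (hab : a ≠ b)
    (h : ∀ z, 0 ≤ meromorphicOrderAt f z)
    (ha : ∀ z, meromorphicOrderAt (fun w => f w - a) z ≤ 0)
    (hb : ∀ z, meromorphicOrderAt (fun w => f w - b) z ≤ 0) : IsConstMeromorphic f := by
  obtain ⟨F, hF, hFf⟩ := hf.exists_differentiable_eventuallyEq h
  obtain ⟨c, hc⟩ := exists_eq_const_of_differentiable_of_ne hF hab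
    (fun z => ne_of_meromorphicOrderAt_sub_nonpos (hf z) (hF z).continuousAt (hFf z) (ha z))
    (fun z => ne_of_meromorphicOrderAt_sub_nonpos (hf z) (hF z).continuousAt (hFf z) (hb z))
  exact isConstMeromorphic_of_eventuallyEq fun z => (hFf z).symm.trans (.of_forall hc)

/-- The Möbius map `1 / (w - a)` moves the omitted value `a` to infinity and `b`, `c` to two
distinct finite values. -/
theorem isConstMeromorphic_of_omits_coe {f : ℂ → ℂ} (hf : Meromorphic f) {a b c : ℂ} (hab : a ≠ b)
    (hac : a ≠ c) (hbc : b ≠ c)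
    (ha : ∀ z, meromorphicOrderAt (fun w => f w - a) z ≤ 0)
    (hb : ∀ z, meromorphicOrderAt (fun w => f w - b) z ≤ 0)
    (hc : ∀ z, meromorphicOrderAt (fun w => f w - c) z ≤ 0) : IsConstMeromorphic f := by
  have hs (d z : ℂ) : MeromorphicAt (fun w => f w - d) z := (hf z).sub (MeromorphicAt.const d z)
  have hh : Meromorphic fun w => (f w - a)⁻¹ := fun z => (hs a z).inv
  have hpole z : 0 ≤ meromorphicOrderAt (fun w => (f w - a)⁻¹) z := by
    change 0 ≤ meromorphicOrderAt (fun w => f w - a)⁻¹ z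
    rw [meromorphicOrderAt_inv]
    have := ha z
    cases h : meromorphicOrderAt (fun w => f w - a) z with
    | top => simp [h] at this
    | coe n =>
      rw [h] at this
      have hn : n ≤ 0 := by exact_mod_cast this
      have hn' : 0 ≤ -n := by omega
      exact_mod_cast hn'
  have homit (d : ℂ) (had : a ≠ d) (hd : ∀ z, meromorphicOrderAt (fun w => f w - d) z ≤ 0) (z : ℂ) :
      meromorphicOrderAt (fun w => (f w - a)⁻¹ - (d - a)⁻¹) z ≤ 0 := by
    by_contra! hlt
    have hda : d - a ≠ 0 := sub_ne_zero.2 had.symm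
    have h1 := (tendsto_zero_of_meromorphicOrderAt_pos hlt).add_const (d - a)⁻¹
    simp only [sub_add_cancel, zero_add] at h1
    have h2 := (h1.inv₀ (inv_ne_zero hda)).sub_const (d - a)
    refine (hd z).not_gt ((tendsto_zero_iff_meromorphicOrderAt_pos (hs d z)).1 ?_)
    simpa using h2
  have hinj : (b - a)⁻¹ ≠ (c - a)⁻¹ := fun h => hbc (sub_left_injective (inv_injective h))
  obtain ⟨k, hk⟩ := isConstMeromorphic_of_omits_top hh hinj hpole (homit b hab hb) (homit c hac hc)
  refine ⟨a + k⁻¹, hk.mono fun z hz => ?_⟩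
  rw [← show (f z - a)⁻¹ = k from hz, inv_inv, add_sub_cancel]

/-- **Little Picard theorem** for meromorphic functions. -/
theorem isConstMeromorphic_of_omitsValue {f : ℂ → ℂ} (hf : Meromorphic f) {a b c : WithTop ℂ}
    (hab : a ≠ b) (hac : a ≠ c) (hbc : b ≠ c) (ha : OmitsValue f a) (hb : OmitsValue f b)
    (hc : OmitsValue f c) : IsConstMeromorphic f := by
  induction a with
  | top =>
    lift b to ℂ using hab.symm
    lift c to ℂ using hac.symm
    exact isConstMeromorphic_of_omits_top hf (by exact_mod_cast hbc) ha hb hc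
  | coe a =>
    induction b with
    | top =>
      lift c to ℂ using hbc.symm
      exact isConstMeromorphic_of_omits_top hf (by exact_mod_cast hac) hb ha hc
    | coe b =>
      induction c with
      | top => exact isConstMeromorphic_of_omits_top hf (by exact_mod_cast hab) hc ha hb
      | coe c =>
        exact isConstMeromorphic_of_omits_coe hf (by exact_mod_cast hab) (by exact_mod_cast hac)
          (by exact_mod_cast hbc) ha hb hc

/-! ### Logarithmic integrals of counting functions -/

theorem integrableOn_indicator_Ici_inv {ρ r : ℝ} (hρ : 0 < ρ) :
    MeasureTheory.IntegrableOn ((Set.Ici ρ).indicator fun t : ℝ => t⁻¹) (Set.Ioc 0 r) := by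
  rw [MeasureTheory.integrableOn_indicator_iff measurableSet_Ici]
  have hc : ContinuousOn (fun t : ℝ => t⁻¹) (Set.Icc ρ r) :=
    continuousOn_inv₀.mono fun t ht => (hρ.trans_le ht.1).ne'
  exact hc.integrableOn_Icc.mono_set fun t ht => ⟨ht.1, ht.2.2⟩

theorem integral_indicator_Ici_inv {ρ r : ℝ} (hρ : 0 < ρ) (hr : ρ ≤ r) :
    ∫ t in (0 : ℝ)..r, (Set.Ici ρ).indicator (fun t : ℝ => t⁻¹) t = Real.log (r * ρ⁻¹) := by
  rw [intervalIntegral.integral_of_le (hρ.le.trans hr),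
    MeasureTheory.setIntegral_indicator measurableSet_Ici,
    show Set.Ioc 0 r ∩ Set.Ici ρ = Set.Icc ρ r by
      ext t
      exact ⟨fun h => ⟨h.2, h.1.2⟩, fun h => ⟨⟨hρ.trans_le h.1, h.2⟩, h.1⟩⟩,
    MeasureTheory.integral_Icc_eq_integral_Ioc, ← intervalIntegral.integral_of_le hr,
    integral_inv_of_pos hρ (hρ.trans_le hr), div_eq_mul_inv]

/-- The logarithmic counting function of a locally finite divisor is the logarithmic integral of
its counting function. -/
theorem Function.locallyFinsuppWithin.integral_add_eq_logCounting (D : Function.locallyFinsupp ℂ ℤ)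
    {n : ℝ → ℝ} (hn : ∀ t, n t = ∑ᶠ z ∈ closedBall (0 : ℂ) t, (D z : ℝ)) {r : ℝ} (hr : 0 < r) :
    (∫ t in (0 : ℝ)..r, (n t - n 0) / t) + n 0 * Real.log r = logCounting D r := by
  classical
  have hfin : (toClosedBall r D).support.Finite :=
    (toClosedBall r D).finiteSupport (isCompact_closedBall _ _)
  set S : Finset ℂ := insert 0 hfin.toFinset with hS
  have hmem {z : ℂ} (hz : z ∈ S) : z ∈ closedBall (0 : ℂ) |r| := by
    rcases Finset.mem_insert.1 hz with rfl | hz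
    · exact mem_closedBall_self (abs_nonneg r)
    · exact toClosedBall_support_subset_closedBall D (hfin.mem_toFinset.1 hz)
  have hsupp {z : ℂ} (hz : z ∈ closedBall (0 : ℂ) |r|) (h0 : D z ≠ 0) : z ∈ S := by
    refine Finset.mem_insert_of_mem (hfin.mem_toFinset.2 ?_)
    rwa [Function.mem_support, toClosedBall_eval_within D hz]
  have hn0 : n 0 = D 0 := by
    rw [hn, closedBall_zero, finsum_mem_singleton]
  -- Subtracting `n 0` removes the origin; every other point contributes `D z / t` from `t = ‖z‖`
  -- on.
  have hnt {t : ℝ} (ht : t ∈ Set.Ioc 0 r) :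
      (n t - n 0) / t =
        ∑ z ∈ S.erase 0, (D z : ℝ) * (Set.Ici ‖z‖).indicator (fun t : ℝ => t⁻¹) t := by
    have h1 : n t = ∑ z ∈ S, (closedBall (0 : ℂ) t).indicator (fun z => (D z : ℝ)) z := by
      rw [hn, finsum_mem_def]
      refine finsum_eq_sum_of_support_subset _ fun z hz => ?_
      rw [Set.support_indicator] at hz
      refine hsupp (closedBall_subset_closedBall (ht.2.trans (le_abs_self r)) hz.1) ?_
      exact fun h => hz.2 (by simp [h])
    rw [h1, hn0, ← Finset.add_sum_erase S _ (Finset.mem_insert_self _ _),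
      Set.indicator_of_mem (mem_closedBall_self ht.1.le), add_sub_cancel_left, Finset.sum_div]
    refine Finset.sum_congr rfl fun z _ => ?_
    by_cases h : ‖z‖ ≤ t <;> simp [Set.indicator, h, div_eq_mul_inv]
  have hint : ∫ t in (0 : ℝ)..r, (n t - n 0) / t =
      ∑ z ∈ S.erase 0, (D z : ℝ) * Real.log (r * ‖z‖⁻¹) := by
    rw [intervalIntegral.integral_congr_uIoo (g := fun t => ∑ z ∈ S.erase 0,
      (D z : ℝ) * (Set.Ici ‖z‖).indicator (fun t : ℝ => t⁻¹) t) fun t ht => hnt (by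
        rw [Set.uIoo_of_le hr.le] at ht; exact ⟨ht.1, ht.2.le⟩),
      intervalIntegral.integral_finsetSum]
    · refine Finset.sum_congr rfl fun z hz => ?_
      have hz' := hmem (Finset.mem_of_mem_erase hz)
      rw [mem_closedBall_zero_iff, abs_of_pos hr] at hz'
      rw [intervalIntegral.integral_const_mul,
        integral_indicator_Ici_inv (norm_pos_iff.2 (Finset.ne_of_mem_erase hz)) hz']
    · intro z hz
      refine IntervalIntegrable.const_mul ?_ _
      rw [intervalIntegrable_iff_integrableOn_Ioc_of_le hr.le]
      exact integrableOn_indicator_Ici_inv (norm_pos_iff.2 (Finset.ne_of_mem_erase hz))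
  have hlog : ∑ᶠ z, (toClosedBall r D z : ℝ) * Real.log (r * ‖z‖⁻¹) =
      ∑ z ∈ S.erase 0, (D z : ℝ) * Real.log (r * ‖z‖⁻¹) := by
    rw [finsum_eq_sum_of_support_subset (s := S), ← Finset.add_sum_erase S _
      (Finset.mem_insert_self _ _)]
    -- The summand at the origin is zero by the conventions `0⁻¹ = 0` and `Real.log 0 = 0`.
    · simp only [norm_zero, inv_zero, mul_zero, Real.log_zero, zero_add]
      refine Finset.sum_congr rfl fun z hz => ?_
      rw [toClosedBall_eval_within D (hmem (Finset.mem_of_mem_erase hz))]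
    · intro z hz
      refine Finset.mem_insert_of_mem (hfin.mem_toFinset.2 fun h => hz ?_)
      simp [h]
  change _ = ∑ᶠ z, (toClosedBall r D z : ℝ) * Real.log (r * ‖z‖⁻¹) + D 0 * Real.log r
  rw [hint, hn0, hlog]

/-! ### Common zeros of a function and its differences -/

theorem commonZeroMult_nonneg (g h : ℂ → ℂ) (z : ℂ) : 0 ≤ commonZeroMult g h z := by
  rw [commonZeroMult, WithTop.untop₀_nonneg]
  exact le_max_left _ _

theorem commonZeroMult_le {g h : ℂ → ℂ} {z : ℂ} (hz : meromorphicOrderAt g z ≠ ⊤) :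
    commonZeroMult g h z ≤ max 0 (meromorphicOrderAt g z).untop₀ := by
  rw [commonZeroMult]
  cases hg : meromorphicOrderAt g z with
  | top => exact absurd hg hz
  | coe n =>
    cases meromorphicOrderAt h z with
    | top => rw [min_top_right]; norm_cast
    | coe m => norm_cast; exact max_le_max_left 0 (min_le_left _ _)

theorem meromorphicOrderAt_pos_of_commonZeroMult_eq {g h : ℂ → ℂ} {z : ℂ}
    (hz : meromorphicOrderAt g z ≠ ⊤) (hpos : 0 < meromorphicOrderAt g z)
    (heq : commonZeroMult g h z = max 0 (meromorphicOrderAt g z).untop₀) :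
    0 < meromorphicOrderAt h z := by
  rw [commonZeroMult] at heq
  cases hg : meromorphicOrderAt g z with
  | top => exact absurd hg hz
  | coe n =>
    cases hh : meromorphicOrderAt h z with
    | top => exact WithTop.coe_lt_top 0
    | coe m =>
      rw [hg] at hpos
      rw [hg, hh] at heq
      norm_cast at hpos heq ⊢
      simp at heq
      omega

/-- The common zeros of `g` and `h` as a divisor. -/
noncomputable def commonZeroDivisor {g : ℂ → ℂ} (hg : Meromorphic g)
    (htop : ∀ z, meromorphicOrderAt g z ≠ ⊤) (h : ℂ → ℂ) : Function.locallyFinsupp ℂ ℤ where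
  toFun := commonZeroMult g h
  supportWithinDomain' := Set.subset_univ _
  supportLocallyFiniteWithinDomain' z hz := by
    obtain ⟨t, ht, hfin⟩ :=
      (MeromorphicOn.divisor g Set.univ).supportLocallyFiniteWithinDomain z hz
    refine ⟨t, ht, hfin.subset fun w hw => ⟨hw.1, fun h0 => hw.2 ?_⟩⟩
    rw [MeromorphicOn.divisor_apply (meromorphicOn_univ.2 hg) (Set.mem_univ w)] at h0
    have h1 := commonZeroMult_le (h := h) (htop w)
    rw [h0, max_self] at h1
    exact h1.antisymm (commonZeroMult_nonneg _ _ _)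

/-- If the zeros of `g` and the common zeros of `g` and `h` have logarithmic counting functions
at bounded distance, then `h` vanishes at every zero of `g`. -/
theorem meromorphicOrderAt_pos_of_isBigO {g h : ℂ → ℂ} (hg : Meromorphic g)
    (htop : ∀ z, meromorphicOrderAt g z ≠ ⊤)
    (hO : (fun r : ℝ => ValueDistribution.logCounting g 0 r -
      ((∫ t in (0 : ℝ)..r, (commonZeroCount g h t - commonZeroCount g h 0) / t) +
        commonZeroCount g h 0 * Real.log r)) =O[atTop] (fun _ : ℝ => (1 : ℝ)))
    {z : ℂ} (hz : 0 < meromorphicOrderAt g z) : 0 < meromorphicOrderAt h z := by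
  set P : Function.locallyFinsupp ℂ ℤ := (MeromorphicOn.divisor g Set.univ)⁺ with hP
  set D := commonZeroDivisor hg htop h with hD
  have hPz w : P w = max 0 (meromorphicOrderAt g w).untop₀ := by
    rw [hP, Function.locallyFinsuppWithin.posPart_apply,
      MeromorphicOn.divisor_apply (meromorphicOn_univ.2 hg) (Set.mem_univ w), posPart_def,
      sup_comm]
  have hle : 0 ≤ P - D := by
    rw [sub_nonneg]
    intro w
    rw [hPz]
    exact commonZeroMult_le (htop w)
  have hlog : (fun r : ℝ => ValueDistribution.logCounting g 0 r -
      ((∫ t in (0 : ℝ)..r, (commonZeroCount g h t - commonZeroCount g h 0) / t) +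
        commonZeroCount g h 0 * Real.log r)) =ᶠ[atTop]
      Function.locallyFinsuppWithin.logCounting (P - D) := by
    filter_upwards [eventually_gt_atTop 0] with r hr
    rw [D.integral_add_eq_logCounting (n := commonZeroCount g h) (fun t => rfl) hr,
      ValueDistribution.logCounting_zero, map_sub, Pi.sub_apply]
  -- A nonzero effective divisor would contribute a term growing like `log r`.
  have h0 := (Function.locallyFinsuppWithin.zero_iff_logCounting_bounded hle).2
    (hO.congr' hlog .rfl)
  refine meromorphicOrderAt_pos_of_commonZeroMult_eq (htop z) hz ?_
  rw [← hPz, sub_eq_zero.1 h0]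
  rfl

theorem eventually_meromorphicOrderAt_eq_zero {g : ℂ → ℂ} (hg : Meromorphic g) {z : ℂ}
    (hz : meromorphicOrderAt g z ≠ ⊤) : ∀ᶠ w in 𝓝[≠] z, meromorphicOrderAt g w = 0 := by
  filter_upwards [(meromorphicOrderAt_ne_top_iff_eventually_ne_zero (hg z)).1 hz,
    (hg z).eventually_analyticAt] with w hw hw'
  exact hw'.meromorphicNFAt.meromorphicOrderAt_eq_zero_iff.2 hw

/-- If all zeros of `g` are, up to a bounded logarithmic counting function, zeros of the forward
differences of `g` with steps tending to zero, then `g` has no zeros. -/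
theorem meromorphicOrderAt_nonpos_of_isBigO_fwdDiff {g : ℂ → ℂ} (hg : Meromorphic g)
    (htop : ∀ z, meromorphicOrderAt g z ≠ ⊤) {η : ℕ → ℂ} (hη : ∀ n, η n ≠ 0)
    (hη0 : Tendsto η atTop (𝓝 0))
    (hO : ∀ n, (fun r : ℝ => ValueDistribution.logCounting g 0 r -
      ((∫ t in (0 : ℝ)..r, (commonZeroCount g (fwdDiff (η n) g) t -
          commonZeroCount g (fwdDiff (η n) g) 0) / t) +
        commonZeroCount g (fwdDiff (η n) g) 0 * Real.log r)) =O[atTop] (fun _ : ℝ => (1 : ℝ)))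
    (z : ℂ) : meromorphicOrderAt g z ≤ 0 := by
  by_contra! hz
  have hshift n : 0 < meromorphicOrderAt g (z + η n) := by
    have hΔ := meromorphicOrderAt_pos_of_isBigO hg htop (hO n) hz
    rw [← meromorphicOrderAt_comp_add_const_eq_meromorphicOrderAt]
    -- Non-meromorphic germs have order 0 by default, so a positive order already gives meromorphy.
    have hΔm : MeromorphicAt (fwdDiff (η n) g) z := meromorphicAt_of_meromorphicOrderAt_ne_zero hΔ.ne'
    have hsum : g ∘ (· + η n) = g + fwdDiff (η n) g := by
      ext w
      simp [fwdDiff]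
    rw [hsum]
    exact (lt_min hz hΔ).trans_le (meromorphicOrderAt_add (hg z) hΔm)
  -- The steps are nonzero, so the zeros `z + η n` accumulate at `z` within the punctured
  -- neighbourhood, against isolation of zeros.
  have hlim : Tendsto (fun n => z + η n) atTop (𝓝[≠] z) := by
    refine tendsto_nhdsWithin_iff.2 ⟨by simpa using hη0.const_add z, .of_forall fun n => ?_⟩
    simpa using hη n
  obtain ⟨n, hn⟩ := (hlim.eventually (eventually_meromorphicOrderAt_eq_zero hg (htop z))).exists
  exact (hshift n).ne' hn

/-! ### Exceptional values versus omitted values -/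

/-- The meromorphic function whose zeros are the points where `f` takes the value `a`: it is
`f - a` for finite `a` and `1 / f` for `a = ∞`. -/
noncomputable def valueChart (f : ℂ → ℂ) (a : WithTop ℂ) : ℂ → ℂ :=
  WithTop.recTopCoe (C := fun _ => ℂ → ℂ) (fun z => (f z)⁻¹) (fun a₀ z => f z - a₀) a

theorem Meromorphic.valueChart {f : ℂ → ℂ} (hf : Meromorphic f) (a : WithTop ℂ) :
    Meromorphic (valueChart f a) := by
  intro z
  induction a with
  | top => exact (hf z).inv
  | coe a => exact (hf z).sub (MeromorphicAt.const a z)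

theorem logCounting_valueChart (f : ℂ → ℂ) (a : WithTop ℂ) :
    ValueDistribution.logCounting (valueChart f a) 0 = ValueDistribution.logCounting f a := by
  induction a with
  | top =>
    rw [← ValueDistribution.logCounting_inv, show (valueChart f ⊤)⁻¹ = f from inv_inv f]
  | coe a => exact ValueDistribution.logCounting_coe_eq_logCounting_sub_const_zero.symm

theorem diffCounting_eq_commonZeroCount (η : ℂ) (f : ℂ → ℂ) (a : WithTop ℂ) :
    diffCounting η f a = commonZeroCount (valueChart f a) (fwdDiff η (valueChart f a)) := by
  induction a with
  | top => rfl
  | coe a =>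
    have : fwdDiff η (valueChart f a) = fwdDiff η f := by
      ext z
      simp [fwdDiff, valueChart]
    rw [this]
    rfl

theorem isConstMeromorphic_of_valueChart_eq_top {f : ℂ → ℂ} (hf : Meromorphic f) {a : WithTop ℂ}
    {z : ℂ} (h : meromorphicOrderAt (valueChart f a) z = ⊤) : IsConstMeromorphic f := by
  induction a with
  | top =>
    refine isConstMeromorphic_of_meromorphicOrderAt_sub_eq_top hf (c := 0) (z₀ := z) ?_
    rw [meromorphicOrderAt_eq_top_iff] at h ⊢
    exact h.mono fun w hw => by rw [sub_zero]; exact inv_eq_zero.1 hw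
  | coe a => exact isConstMeromorphic_of_meromorphicOrderAt_sub_eq_top hf h

theorem omitsValue_of_valueChart {f : ℂ → ℂ} {a : WithTop ℂ}
    (h : ∀ z, meromorphicOrderAt (valueChart f a) z ≤ 0) : OmitsValue f a := by
  induction a with
  | top =>
    intro z
    have hz : meromorphicOrderAt f⁻¹ z ≤ 0 := h z
    rw [meromorphicOrderAt_inv] at hz
    cases hf : meromorphicOrderAt f z with
    | top => exact le_top
    | coe n =>
      rw [hf] at hz
      have hn : -n ≤ 0 := by exact_mod_cast hz
      exact_mod_cast (neg_nonpos.1 hn)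
  | coe a => exact h

/-- Order `⊤` occurs only for `a = ∞` and `f` vanishing near `z` off `z` itself, where the
convention `0⁻¹ = 0` makes the chart vanish too. -/
theorem OmitsValue.order_valueChart_eq_top_or_nonpos {f : ℂ → ℂ} {a : WithTop ℂ} (h : OmitsValue f a)
    (z : ℂ) : meromorphicOrderAt (valueChart f a) z = ⊤ ∨
      meromorphicOrderAt (valueChart f a) z ≤ 0 := by
  induction a with
  | top =>
    have hz : 0 ≤ meromorphicOrderAt f z := h z
    change meromorphicOrderAt f⁻¹ z = ⊤ ∨ meromorphicOrderAt f⁻¹ z ≤ 0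
    rw [meromorphicOrderAt_inv]
    cases hf : meromorphicOrderAt f z with
    | top => exact .inl rfl
    | coe n =>
      rw [hf] at hz
      have hn : 0 ≤ n := by exact_mod_cast hz
      have hn' : -n ≤ 0 := by omega
      exact .inr (by exact_mod_cast hn')
  | coe a => exact .inr (h z)

/-- For a nonconstant function, exceptional values are omitted. -/
theorem IsVanishingPicardExceptional.omitsValue {f : ℂ → ℂ} (hf : Meromorphic f) {a : WithTop ℂ}
    (h : IsVanishingPicardExceptional f a) (hconst : ¬ IsConstMeromorphic f) : OmitsValue f a := by
  obtain ⟨η, hη, hη0, hO⟩ := h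
  refine omitsValue_of_valueChart (meromorphicOrderAt_nonpos_of_isBigO_fwdDiff (hf.valueChart a)
    (fun z hz => hconst (isConstMeromorphic_of_valueChart_eq_top hf hz)) hη hη0 fun n => ?_)
  simpa only [reducedDiffLogCounting, diffLogCounting, diffCounting_eq_commonZeroCount,
    logCounting_valueChart] using hO n

theorem OmitsValue.diffLogCounting_eq_zero {f : ℂ → ℂ} (hf : Meromorphic f) {a : WithTop ℂ}
    (h : OmitsValue f a) (η : ℂ) (r : ℝ) : diffLogCounting η f a r = 0 := by
  have hmult z : commonZeroMult (valueChart f a) (fwdDiff η (valueChart f a)) z = 0 := by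
    by_cases htop : meromorphicOrderAt (valueChart f a) z = ⊤
    -- An identically vanishing chart has vanishing differences, and `untop₀` sends the resulting
    -- `⊤` to 0.
    · have hΔ : meromorphicOrderAt (fwdDiff η (valueChart f a)) z = ⊤ := by
        have hchart := hf.valueChart a
        have hs : meromorphicOrderAt (valueChart f a ∘ (· + η)) z = ⊤ := by
          rw [meromorphicOrderAt_comp_add_const_eq_meromorphicOrderAt]
          exact hchart.meromorphicOrderAt_eq_top htop _
        rw [meromorphicOrderAt_eq_top_iff] at hs htop ⊢
        filter_upwards [hs, htop] with w hw hw'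
        rw [fwdDiff, hw', show valueChart f a (w + η) = 0 from hw, sub_zero]
      rw [commonZeroMult, htop, hΔ, min_self, max_top_right, WithTop.untop₀_top]
    · rcases h.order_valueChart_eq_top_or_nonpos z with h' | h'
      · exact absurd h' htop
      · rw [commonZeroMult, max_eq_left ((min_le_left _ _).trans h'), WithTop.untop₀_zero]
  have hcount t : diffCounting η f a t = 0 := by
    simp [diffCounting_eq_commonZeroCount, commonZeroCount, hmult]
  simp [diffLogCounting, hcount]

theorem OmitsValue.logCounting_eq_zero {f : ℂ → ℂ} (hf : Meromorphic f) {a : WithTop ℂ}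
    (h : OmitsValue f a) : ValueDistribution.logCounting f a = 0 := by
  have hdiv : (MeromorphicOn.divisor (valueChart f a) Set.univ)⁺ = 0 := by
    rw [posPart_eq_zero]
    intro z
    rw [MeromorphicOn.divisor_apply (meromorphicOn_univ.2 (hf.valueChart a)) (Set.mem_univ z)]
    rcases h.order_valueChart_eq_top_or_nonpos z with h' | h'
    · rw [h', WithTop.untop₀_top]; rfl
    · change (meromorphicOrderAt (valueChart f a) z).untop₀ ≤ 0
      cases hz : meromorphicOrderAt (valueChart f a) z with
      | top => exact le_rfl
      | coe n =>
        rw [hz] at h'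
        exact_mod_cast h'
  rw [← logCounting_valueChart, ValueDistribution.logCounting_zero, hdiv, map_zero]

theorem OmitsValue.isVanishingPicardExceptional {f : ℂ → ℂ} (hf : Meromorphic f) {a : WithTop ℂ}
    (h : OmitsValue f a) : IsVanishingPicardExceptional f a := by
  -- Any nonzero null sequence would do, as both counting functions vanish identically.
  refine ⟨fun n => 1 / ((n : ℂ) + 1), fun n => ?_, tendsto_one_div_add_atTop_nhds_zero_nat,
    fun n => ?_⟩
  · exact one_div_ne_zero (Nat.cast_add_one_ne_zero n)
  · have : (fun r : ℝ => reducedDiffLogCounting (1 / ((n : ℂ) + 1)) f a r) = fun _ => 0 := by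
      ext r
      rw [reducedDiffLogCounting, h.logCounting_eq_zero hf, h.diffLogCounting_eq_zero hf,
        Pi.zero_apply, sub_zero]
    rw [this]
    exact Asymptotics.isBigO_zero _ _

theorem theoremT (f : ℂ → ℂ) (hf : Meromorphic f) :
    -- three exceptional values force `f` to be constant
    (∀ a b c : WithTop ℂ, a ≠ b → a ≠ c → b ≠ c →
      IsVanishingPicardExceptional f a → IsVanishingPicardExceptional f b →
      IsVanishingPicardExceptional f c → IsConstMeromorphic f) ∧
    -- omitted values are exceptional, whence the classical little Picard theorem
    (∀ a : WithTop ℂ, OmitsValue f a → IsVanishingPicardExceptional f a) ∧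
    (∀ a b c : WithTop ℂ, a ≠ b → a ≠ c → b ≠ c →
      OmitsValue f a → OmitsValue f b → OmitsValue f c → IsConstMeromorphic f) := by
  refine ⟨fun a b c hab hac hbc ha hb hc => ?_, fun a ha => ha.isVanishingPicardExceptional hf,
    fun a b c hab hac hbc => isConstMeromorphic_of_omitsValue hf hab hac hbc⟩
  by_contra hconst
  exact hconst (isConstMeromorphic_of_omitsValue hf hab hac hbc (ha.omitsValue hf hconst)
    (hb.omitsValue hf hconst) (hc.omitsValue hf hconst))
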